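/- Let $n,k\ge 1$ be integers and let $\mathcal G$ be a partition of the set of agents $N=\{1,\dots,n\}$ into nonempty groups; write $G_i\in\mathcal G$ for the group containing agent $i$. A feasible allocation of $k$ identical tickets is a vector $x\in\{0,1,\dots,k\}^n$ with $\sum_{i} x_i\le k$, and a lottery allocation is a probability distribution $\pi$ over feasible allocations. The utility of agent $i$ is $u_i(x)=1$ if $\sum_{j\in G_i}x_j\ge |G_i|$ and $u_i(x)=0$ otherwise, and $u_i(\pi)=\sum_x \pi_x u_i(x)$. A lottery allocation $\pi$ is $\beta$-efficient if $\frac1k\sum_{i\in N}u_i(\pi)\ge\beta$, and $\beta$-fair if $u_i(\pi)\ge\beta\,u_{i'}(\pi)$ for all $i,i'\in N$. In the Weighted Individual Lottery each agent $i$ requests a number $a_i\in\{1,\dots,k\}$ of tickets. A random order $\Sigma$ of the agents is generated by drawing agents sequentially without replacement with probability inversely proportional to their request, that is, for every order $\sigma=(\sigma_1,\dots,\sigma_n)$ of $N$, $$\mathbb P(\Sigma=\sigma)=\prod_{t=1}^{n}\frac{1/a_{\sigma_t}}{\sum_{i\in N\setminus\{\sigma_1,\dots,\sigma_{t-1}\}}1/a_i}.$$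 The agents are processed in this order, and each agent receives the minimum of its request and the number of remaining tickets: $$x_{\sigma_t}=\min\Bigl\{a_{\sigma_t},\ \max\Bigl\{k-\sum_{s<t}a_{\sigma_s},\,0\Bigr\}\Bigr\}.$$ The group request outcome is the resulting lottery allocation when every agent $i$ requests $a_i=|G_i|$ tickets. For $\kappa,\alpha\in(0,1)$ let $I(\kappa,\alpha)$ be the family of all instances $(n,k,\mathcal G)$ with $$\frac{\max_{G\in\mathcal G}|G|-1}{k}\le\kappa\quad\text{and}\quad\frac kn\le\alpha$$ (so that $|G|\le k$ for every $G\in\mathcal G$ and the group requests are admissible), and let $g(x)=(1-e^{-x})/x$ for $x>0$. **Theorem.** Fix $\kappa,\alpha\in(0,1)$. For every instance in $I(\kappa,\alpha)$, the group request outcome of the Weighted Individual Lottery is $(1-\kappa)g(\alpha)$-efficient and $(1-2\kappa)g(\alpha)$-fair. -/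

import Mathlib

namespace TicketLottery

noncomputable section

/-! ### Feasible allocations and lottery allocations -/

/-- Feasible allocations of `k` identical tickets to `n` agents: `x i ∈ {0, …, k}` is the number of
tickets of agent `i`, and at most `k` tickets are handed out in total. -/
abbrev Allocation (n k : ℕ) : Type :=
  {x : Fin n → Fin (k + 1) // ∑ i, (x i : ℕ) ≤ k}

/-- Lottery allocations: probability distributions over the feasible allocations. -/
abbrev LotteryAllocation (n k : ℕ) : Type :=
  stdSimplex ℝ (Allocation n k)

/-! ### Instances, utilities, efficiency and fairness -/

/-- An instance: `n ≥ 1` agents, `k ≥ 1` tickets and a partition of the agents into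
(nonempty) groups. -/
structure LotteryInstance where
  n : ℕ
  k : ℕ
  n_pos : 0 < n
  k_pos : 0 < k
  groups : Finpartition (Finset.univ : Finset (Fin n))

namespace LotteryInstance

variable (I : LotteryInstance)

/-- The group `G_i` that contains agent `i`. -/
def group (i : Fin I.n) : Finset (Fin I.n) := I.groups.part i

/-- The maximum size of a group. -/
def maxGroupSize : ℕ := I.groups.parts.sup Finset.card

/-- The utility `u_i(x) ∈ {0, 1}`: agent `i` is successful iff the members of its group together
receive at least as many tickets as the group has members. -/
def utility (i : Fin I.n) (x : Allocation I.n I.k) : ℝ :=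
  if (I.group i).card ≤ ∑ j ∈ I.group i, (x.1 j : ℕ) then 1 else 0

/-- The expected utility `u_i(π)` of agent `i` under a lottery allocation `π`. -/
def expectedUtility (i : Fin I.n) (π : LotteryAllocation I.n I.k) : ℝ :=
  ∑ x, π.1 x * I.utility i x

/-- The expected utilization `U(π) = (1/k) ∑ i, u_i(π)`. -/
def utilization (π : LotteryAllocation I.n I.k) : ℝ :=
  1 / (I.k : ℝ) * ∑ i, I.expectedUtility i π

/-- `β`-efficiency: `U(π) ≥ β`. -/
def IsEfficient (β : ℝ) (π : LotteryAllocation I.n I.k) : Prop :=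
  β ≤ I.utilization π

/-- `β`-fairness: `u_i(π) ≥ β u_{i'}(π)` for all agents `i`, `i'`. -/
def IsFair (β : ℝ) (π : LotteryAllocation I.n I.k) : Prop :=
  ∀ i i' : Fin I.n, β * I.expectedUtility i' π ≤ I.expectedUtility i π

end LotteryInstance

/-- The family `I(κ, α)`: `(max_G |G| - 1) / k ≤ κ` and `k / n ≤ α`. -/
def instanceFamily (κ α : ℝ) : Set LotteryInstance :=
  {I | ((I.maxGroupSize : ℝ) - 1) / I.k ≤ κ ∧ (I.k : ℝ) / I.n ≤ α}

/-! ### The Weighted Individual Lottery -/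

/-- The action set `{1, …, k}`: the number of tickets that an agent requests. -/
abbrev Request (k : ℕ) : Type := {a : ℕ // 1 ≤ a ∧ a ≤ k}

/-- An order `σ` over the agents maps each position `t` to the agent `σ t`. This is the set of the
agents in the positions strictly before `t`. -/
def before {n : ℕ} (σ : Equiv.Perm (Fin n)) (t : Fin n) : Finset (Fin n) :=
  (Finset.Iio t).image σ

/-- The number of tickets that agent `i` receives when the agents are processed in the order `σ`:
the minimum of its request and the number of tickets that remain. The subtraction is truncated at
zero. -/
def ticketsOf {n k : ℕ} (a : Fin n → Request k) (σ : Equiv.Perm (Fin n)) (i : Fin n) : ℕ :=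
  min (a i : ℕ) (k - ∑ j ∈ before σ (σ.symm i), (a j : ℕ))

theorem sum_min_sub (k : ℕ) : ∀ (n : ℕ) (f : Fin n → ℕ),
    ∑ t, min (f t) (k - ∑ s ∈ Finset.Iio t, f s) = min k (∑ t, f t) := by
  intro n
  induction n with
  | zero => intro f; simp
  | succ n ih =>
    intro f
    have h1 : ∀ t : Fin n, ∑ s ∈ Finset.Iio t.castSucc, f s
        = ∑ s ∈ Finset.Iio t, f s.castSucc := by
      intro t
      rw [← Fin.map_castSuccEmb_Iio, Finset.sum_map]
      rfl
    have h2 : ∑ s ∈ Finset.Iio (Fin.last n), f s = ∑ s : Fin n, f s.castSucc := by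
      rw [Fin.Iio_last_eq_map, Finset.sum_map]
      rfl
    rw [Fin.sum_univ_castSucc, Fin.sum_univ_castSucc, h2]
    simp only [h1]
    rw [ih (fun t => f t.castSucc)]
    omega

theorem sum_ticketsOf_le {n k : ℕ} (a : Fin n → Request k) (σ : Equiv.Perm (Fin n)) :
    ∑ i, ticketsOf a σ i ≤ k := by
  have h : ∑ i, ticketsOf a σ i
      = ∑ t, min (a (σ t) : ℕ) (k - ∑ s ∈ Finset.Iio t, (a (σ s) : ℕ)) := by
    rw [← Equiv.sum_comp σ]
    refine Finset.sum_congr rfl fun t _ => ?_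
    simp [ticketsOf, before, Finset.sum_image σ.injective.injOn]
  rw [h, sum_min_sub k n (fun t => (a (σ t) : ℕ))]
  exact min_le_left _ _

/-- The feasible allocation that results from processing the agents in the order `σ`. -/
def allocate {n k : ℕ} (a : Fin n → Request k) (σ : Equiv.Perm (Fin n)) : Allocation n k :=
  ⟨fun i => ⟨ticketsOf a σ i, Nat.lt_succ_of_le
      ((Finset.single_le_sum (f := ticketsOf a σ) (fun _ _ => Nat.zero_le _)
        (Finset.mem_univ i)).trans (sum_ticketsOf_le a σ))⟩,
    sum_ticketsOf_le a σ⟩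

/-- The probability of the order `σ` when agents are drawn sequentially without replacement, each
time with probability proportional to the weights `w` of the agents that are left. -/
def drawProb {n : ℕ} (w : Fin n → ℝ) (σ : Equiv.Perm (Fin n)) : ℝ :=
  ∏ t, w (σ t) / ∑ i ∈ Finset.univ \ before σ t, w i

theorem sum_compl_before {n : ℕ} (w : Fin n → ℝ) (σ : Equiv.Perm (Fin n)) (t : Fin n) :
    ∑ i ∈ Finset.univ \ before σ t, w i = ∑ s ∈ Finset.Ici t, w (σ s) := by
  rw [← Finset.sum_image (f := w) (g := σ) σ.injective.injOn]
  congr 1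
  ext i
  simp only [before, Finset.mem_sdiff, Finset.mem_univ, true_and, Finset.mem_image,
    Finset.mem_Iio, Finset.mem_Ici]
  constructor
  · intro h
    exact ⟨σ.symm i, not_lt.1 fun hl => h ⟨_, hl, by simp⟩, by simp⟩
  · rintro ⟨s, hs, rfl⟩ ⟨r, hr, hrs⟩
    rw [σ.injective hrs] at hr
    exact absurd hr (not_lt.2 hs)

theorem sum_drawProb : ∀ (n : ℕ) (w : Fin n → ℝ), (∀ i, 0 < w i) →
    ∑ σ : Equiv.Perm (Fin n), drawProb w σ = 1 := by
  intro n
  induction n with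
  | zero => intro w _; simp [drawProb]
  | succ n ih =>
    intro w hw
    have hpos : 0 < ∑ i, w i :=
      Finset.sum_pos (fun i _ => hw i) Finset.univ_nonempty
    have key : ∀ (p : Fin (n + 1)) (e : Equiv.Perm (Fin n)),
        drawProb w (Equiv.Perm.decomposeFin.symm (p, e))
          = w p / (∑ i, w i) * drawProb (fun j => w (Equiv.swap 0 p j.succ)) e := by
      intro p e
      simp only [drawProb, sum_compl_before]
      rw [Fin.prod_univ_succ]
      congr 1
      · rw [Equiv.Perm.decomposeFin_symm_apply_zero]
        congr 1
        have : (Finset.Ici (0 : Fin (n + 1))) = Finset.univ := by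
          ext i; simp
        rw [this, Equiv.sum_comp (Equiv.Perm.decomposeFin.symm (p, e)) w]
      · refine Finset.prod_congr rfl fun t _ => ?_
        rw [Equiv.Perm.decomposeFin_symm_apply_succ]
        congr 1
        rw [← Fin.map_succEmb_Ici, Finset.sum_map]
        refine Finset.sum_congr rfl fun s _ => ?_
        simp [Equiv.Perm.decomposeFin_symm_apply_succ]
    rw [← Equiv.sum_comp Equiv.Perm.decomposeFin.symm, Fintype.sum_prod_type]
    simp only [key]
    simp only [← Finset.mul_sum]
    have h1 : ∀ p : Fin (n + 1), ∑ e : Equiv.Perm (Fin n),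
        drawProb (fun j => w (Equiv.swap 0 p j.succ)) e = 1 :=
      fun p => ih _ fun _ => hw _
    simp only [h1, mul_one]
    rw [← Finset.sum_div, div_self hpos.ne']

/-- The law of the random order of the Weighted Individual Lottery: agents are drawn sequentially
without replacement, with probability inversely proportional to their request. -/
def orderProb {n k : ℕ} (a : Fin n → Request k) (σ : Equiv.Perm (Fin n)) : ℝ :=
  drawProb (fun i => 1 / ((a i : ℕ) : ℝ)) σ

/-- The Weighted Individual Lottery: the allocation `x` has the probability of the set of the orders
that lead to `x`. -/
def weightedIndividualLottery {n k : ℕ} (a : Fin n → Request k) : LotteryAllocation n k :=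
  ⟨fun x => ∑ σ : Equiv.Perm (Fin n), if x = allocate a σ then orderProb a σ else 0, by
    have hw : ∀ i, (0 : ℝ) < 1 / ((a i : ℕ) : ℝ) := fun i => by
      have : 0 < (a i : ℕ) := (a i).2.1
      positivity
    constructor
    · intro x
      refine Finset.sum_nonneg fun σ _ => ?_
      split_ifs
      · unfold orderProb drawProb
        exact Finset.prod_nonneg fun t _ =>
          div_nonneg (hw (σ t)).le (Finset.sum_nonneg fun i _ => (hw i).le)
      · exact le_rfl
    · rw [Finset.sum_comm]
      simp only [Finset.sum_ite_eq', Finset.mem_univ, if_true]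
      exact sum_drawProb n _ hw⟩

/-! ### The group request strategy -/

/-- The group request profile: each agent `i` requests `|G_i|` tickets. This is a profile of
admissible actions when no group has more than `k` members. -/
def LotteryInstance.groupRequest (I : LotteryInstance) (h : I.maxGroupSize ≤ I.k) :
    Fin I.n → Request I.k := fun i =>
  ⟨(I.group i).card,
    Finset.card_pos.2 ⟨i, I.groups.mem_part (Finset.mem_univ i)⟩,
    (Finset.le_sup (f := Finset.card) (I.groups.part_mem.2 (Finset.mem_univ i))).trans h⟩

theorem maxGroupSize_le {κ α : ℝ} (hκ : κ < 1) {I : LotteryInstance}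
    (hI : I ∈ instanceFamily κ α) : I.maxGroupSize ≤ I.k := by
  have hk : (0 : ℝ) < I.k := by exact_mod_cast I.k_pos
  have h1 : ((I.maxGroupSize : ℝ) - 1) / I.k < 1 := lt_of_le_of_lt hI.1 hκ
  rw [div_lt_one hk] at h1
  have h2 : (I.maxGroupSize : ℝ) < (I.k : ℝ) + 1 := by linarith
  have h3 : I.maxGroupSize < I.k + 1 := by exact_mod_cast h2
  omega

/-- The function `g(x) = (1 - e^{-x}) / x`, for `x > 0`. -/
def g (x : ℝ) : ℝ := (1 - Real.exp (-x)) / x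

end

end TicketLottery

/-! When everyone requests the size of its group, a group is fully served or fails according to its
first processed member alone, so utilities become probabilities that this member is drawn early
enough. The members of a group `G` have weight `1/|G|` each, hence total weight 1.

Conditioning on the first draw gives a recursion for the winning probability in terms of the number
`R` of tickets already requested (`winProb_succ_mul`). Two explicit functions of `R` satisfy it as
inequalities: an exponential from below (`one_sub_exp_le_winProb`) and a ratio from above
(`winProb_le_div`). With `m` the maximum group size, every agent's utility then lies between `1 -
exp(-(k-m+1)/n)` and `(k+m-1)/n`.

Since `m - 1 ≤ κk` and `1 - exp(-x)` is concave, these become `(1-κ)(k/n)g(α)` and `(1+κ)k/n`.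
Summing the lower bound gives efficiency; comparing the two gives fairness, because `(1-2κ)(1+κ) ≤
1-κ`. -/

namespace TicketLottery

noncomputable section

/-! ### The first draw -/

/-- The relabelling of the agents other than `p` by `Fin n`. -/
def skip {n : ℕ} (p : Fin (n + 1)) (j : Fin n) : Fin (n + 1) := Equiv.swap 0 p j.succ

theorem sum_skip {n : ℕ} (p : Fin (n + 1)) (f : Fin (n + 1) → ℝ) :
    ∑ j, f (skip p j) = ∑ i, f i - f p := by
  rw [← Equiv.sum_comp (Equiv.swap 0 p) f, Fin.sum_univ_succ]
  simp [skip]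

/-- Once `p` has been drawn first, the rest of the order is the same sequential draw on the
remaining agents; all inductions below rest on this. -/
theorem drawProb_decomposeFin {n : ℕ} (w : Fin (n + 1) → ℝ) (p : Fin (n + 1))
    (e : Equiv.Perm (Fin n)) :
    drawProb w (Equiv.Perm.decomposeFin.symm (p, e))
      = w p / (∑ i, w i) * drawProb (fun j => w (skip p j)) e := by
  simp only [drawProb, sum_compl_before, skip]
  rw [Fin.prod_univ_succ]
  congr 1
  · rw [Equiv.Perm.decomposeFin_symm_apply_zero]
    congr 1
    have : (Finset.Ici (0 : Fin (n + 1))) = Finset.univ := by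
      ext i; simp
    rw [this, Equiv.sum_comp (Equiv.Perm.decomposeFin.symm (p, e)) w]
  · refine Finset.prod_congr rfl fun t _ => ?_
    rw [Equiv.Perm.decomposeFin_symm_apply_succ]
    congr 1
    rw [← Fin.map_succEmb_Ici, Finset.sum_map]
    refine Finset.sum_congr rfl fun s _ => ?_
    simp [Equiv.Perm.decomposeFin_symm_apply_succ]

theorem drawProb_nonneg {n : ℕ} {w : Fin n → ℝ} (hw : ∀ i, 0 < w i) (σ : Equiv.Perm (Fin n)) :
    0 ≤ drawProb w σ :=
  Finset.prod_nonneg fun t _ =>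
    div_nonneg (hw (σ t)).le (Finset.sum_nonneg fun i _ => (hw i).le)

/-! ### The winning probability of a group -/

/-- Some agent of the group `γ` is processed when at most `K` tickets have been requested, given
that `R` tickets were requested before the first agent in the order `σ`. -/
def Wins {n : ℕ} (a : Fin n → ℕ) (γ : Fin n → Prop) (R K : ℕ) (σ : Equiv.Perm (Fin n)) : Prop :=
  ∃ t, γ (σ t) ∧ R + ∑ s ∈ Finset.Iio t, a (σ s) ≤ K

open Classical in
/-- The probability of `Wins` when the agents are drawn with weights inversely proportional to
their requests. -/
def winProb {n : ℕ} (a : Fin n → ℕ) (γ : Fin n → Prop) (R K : ℕ) : ℝ :=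
  ∑ σ : Equiv.Perm (Fin n), drawProb (fun i => 1 / (a i : ℝ)) σ * if Wins a γ R K σ then 1 else 0

theorem winProb_nonneg {n : ℕ} {a : Fin n → ℕ} (ha : ∀ i, 1 ≤ a i) (γ : Fin n → Prop)
    (R K : ℕ) : 0 ≤ winProb a γ R K := by
  refine Finset.sum_nonneg fun σ _ => mul_nonneg (drawProb_nonneg (fun i => ?_) σ) ?_
  · have : 0 < a i := ha i
    positivity
  · split_ifs <;> simp

theorem winProb_le_one {n : ℕ} {a : Fin n → ℕ} (ha : ∀ i, 1 ≤ a i) (γ : Fin n → Prop)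
    (R K : ℕ) : winProb a γ R K ≤ 1 := by
  have hw : ∀ i, (0 : ℝ) < 1 / (a i : ℝ) := fun i => by
    have : 0 < a i := ha i
    positivity
  rw [← sum_drawProb n _ hw]
  refine Finset.sum_le_sum fun σ _ => mul_le_of_le_one_right (drawProb_nonneg hw σ) ?_
  split_ifs <;> simp

theorem winProb_eq_zero_of_lt {n : ℕ} (a : Fin n → ℕ) (γ : Fin n → Prop) {R K : ℕ} (h : K < R) :
    winProb a γ R K = 0 := by
  refine Finset.sum_eq_zero fun σ _ => ?_
  rw [if_neg, mul_zero]
  rintro ⟨t, -, ht⟩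
  omega

theorem wins_decomposeFin {n : ℕ} (a : Fin (n + 1) → ℕ) (γ : Fin (n + 1) → Prop) {R K : ℕ}
    (hR : R ≤ K) (p : Fin (n + 1)) (e : Equiv.Perm (Fin n)) :
    Wins a γ R K (Equiv.Perm.decomposeFin.symm (p, e)) ↔
      γ p ∨ Wins (fun j => a (skip p j)) (fun j => γ (skip p j)) (R + a p) K e := by
  have h0 : Finset.Iio (0 : Fin (n + 1)) = ∅ := by
    ext i; simp
  have hs : ∀ t : Fin n, ∑ s ∈ Finset.Iio t.succ, a (Equiv.Perm.decomposeFin.symm (p, e) s)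
      = a p + ∑ s ∈ Finset.Iio t, a (skip p (e s)) := by
    intro t
    have : Finset.Iio t.succ = insert 0 ((Finset.Iio t).map (Fin.succEmb n)) := by
      ext i
      refine Fin.cases ?_ (fun j => ?_) i <;> simp
    rw [this, Finset.sum_insert (by simp), Finset.sum_map]
    simp [skip, Equiv.Perm.decomposeFin_symm_apply_succ]
  unfold Wins
  rw [Fin.exists_fin_succ]
  refine or_congr ?_ (exists_congr fun t => ?_)
  · rw [h0, Equiv.Perm.decomposeFin_symm_apply_zero]
    simp [hR]
  · rw [hs, Equiv.Perm.decomposeFin_symm_apply_succ, add_assoc]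
    rfl

/-! ### Recursion on the first draw -/

open Classical in
theorem winProb_succ {n : ℕ} {a : Fin (n + 1) → ℕ} (ha : ∀ i, 1 ≤ a i)
    (γ : Fin (n + 1) → Prop) {R K : ℕ} (hR : R ≤ K) :
    winProb a γ R K = ∑ p, (1 / (a p : ℝ)) / (∑ i, 1 / (a i : ℝ)) *
      if γ p then 1 else winProb (fun j => a (skip p j)) (fun j => γ (skip p j)) (R + a p) K := by
  unfold winProb
  rw [← Equiv.sum_comp Equiv.Perm.decomposeFin.symm, Fintype.sum_prod_type]
  refine Finset.sum_congr rfl fun p _ => ?_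
  simp only [drawProb_decomposeFin, wins_decomposeFin a γ hR, mul_assoc]
  rw [← Finset.mul_sum]
  congr 1
  by_cases hp : γ p
  · simp only [hp, true_or, if_true, mul_one]
    refine sum_drawProb n _ fun j => ?_
    have : 0 < a (skip p j) := ha _
    positivity
  · simp [hp]

open Classical in
/-- The recursion of `winProb` when the total weight of the group `γ` is one. -/
theorem winProb_succ_mul {n : ℕ} {a : Fin (n + 1) → ℕ} (ha : ∀ i, 1 ≤ a i)
    (γ : Fin (n + 1) → Prop) (hγ : ∑ i, (if γ i then 1 / (a i : ℝ) else 0) = 1)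
    {R K : ℕ} (hR : R ≤ K) :
    winProb a γ R K * (1 + ∑ p, if γ p then 0 else 1 / (a p : ℝ)) =
      1 + ∑ p, if γ p then 0 else 1 / (a p : ℝ) *
        winProb (fun j => a (skip p j)) (fun j => γ (skip p j)) (R + a p) K := by
  have hpos : 0 < ∑ i, 1 / (a i : ℝ) := Finset.sum_pos (fun i _ => by
    have : 0 < a i := ha i
    positivity) Finset.univ_nonempty
  have hsum : (1 + ∑ p, if γ p then 0 else 1 / (a p : ℝ)) = ∑ i, 1 / (a i : ℝ) := by
    conv_lhs => enter [1]; rw [← hγ]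
    rw [← Finset.sum_add_distrib]
    refine Finset.sum_congr rfl fun i _ => ?_
    split_ifs <;> simp
  rw [hsum, winProb_succ ha γ hR, Finset.sum_mul]
  conv_rhs => enter [1]; rw [← hγ]
  rw [← Finset.sum_add_distrib]
  refine Finset.sum_congr rfl fun i _ => ?_
  rw [div_mul_eq_mul_div, div_mul_cancel₀ _ hpos.ne']
  split_ifs <;> simp

/-! ### Lower and upper bounds by induction on the number of agents -/

open Classical in
-- The last hypothesis is exactly what makes `1 - exp(θ(R-(K+1)))` a subsolution of the recursion.
-- It survives the removal of an agent outside `γ`, since each summand is nonnegative.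
theorem one_sub_exp_le_winProb (θ : ℝ) (hθ : 0 ≤ θ) (K : ℕ) : ∀ (n : ℕ) (a : Fin n → ℕ)
    (γ : Fin n → Prop) (R : ℕ), (∀ i, 1 ≤ a i) →
    ∑ i, (if γ i then 1 / (a i : ℝ) else 0) = 1 →
    ∑ i, (if γ i then 0 else 1 / (a i : ℝ) * (Real.exp (θ * a i) - 1)) ≤ 1 →
    1 - Real.exp (θ * (R - (K + 1))) ≤ winProb a γ R K := by
  intro n
  induction n with
  | zero => intro a γ R _ h; simp at h
  | succ n ih =>
    intro a γ R ha hγ hexp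
    -- The bound vanishes at `R = K + 1`, the first integer at which winning is impossible.
    rcases lt_or_ge K R with hR | hR
    · refine le_trans ?_ (winProb_nonneg ha γ R K)
      have : (K : ℝ) + 1 ≤ R := by exact_mod_cast hR
      rw [sub_nonpos, Real.one_le_exp_iff]
      exact mul_nonneg hθ (by linarith)
    have hpos : 0 < 1 + ∑ p, (if γ p then 0 else 1 / (a p : ℝ)) := by
      have : 0 ≤ ∑ p, (if γ p then 0 else 1 / (a p : ℝ)) :=
        Finset.sum_nonneg fun p _ => by split_ifs <;> positivity
      linarith
    refine le_of_mul_le_mul_right ?_ hpos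
    rw [winProb_succ_mul ha γ hγ hR]
    set E := Real.exp (θ * (R - (K + 1))) with hE
    have hE0 : 0 < E := Real.exp_pos _
    have step : ∑ p, (if γ p then 0 else 1 / (a p : ℝ) * (1 - E * Real.exp (θ * a p))) ≤
        ∑ p, (if γ p then 0 else 1 / (a p : ℝ) *
          winProb (fun j => a (skip p j)) (fun j => γ (skip p j)) (R + a p) K) := by
      refine Finset.sum_le_sum fun p _ => ?_
      by_cases hp : γ p
      · simp [hp]
      simp only [hp, if_false]
      refine mul_le_mul_of_nonneg_left ?_ (by positivity)
      refine le_trans (le_of_eq ?_) (ih _ _ (R + a p) (fun j => ha _) ?_ ?_)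
      · rw [hE, ← Real.exp_add]
        push_cast
        ring_nf
      · rw [sum_skip p (fun i => if γ i then 1 / (a i : ℝ) else 0), hγ]
        simp [hp]
      · rw [sum_skip p (fun i => if γ i then 0 else 1 / (a i : ℝ) * (Real.exp (θ * a i) - 1))]
        simp only [hp, if_false]
        have : 0 ≤ 1 / (a p : ℝ) * (Real.exp (θ * a p) - 1) := by
          refine mul_nonneg (by positivity) (sub_nonneg.2 (Real.one_le_exp (by positivity)))
        linarith
    have expand : ∑ p, (if γ p then 0 else 1 / (a p : ℝ) * (1 - E * Real.exp (θ * a p))) =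
        (1 - E) * ∑ p, (if γ p then 0 else 1 / (a p : ℝ)) -
        E * ∑ p, (if γ p then 0 else 1 / (a p : ℝ) * (Real.exp (θ * a p) - 1)) := by
      rw [Finset.mul_sum, Finset.mul_sum, ← Finset.sum_sub_distrib]
      refine Finset.sum_congr rfl fun p _ => ?_
      split_ifs
      · simp
      · ring
    have := mul_le_mul_of_nonneg_left hexp hE0.le
    linarith

open Classical in
-- The bound is `1 - c/(L-R)` with `c = L-K-m`, a supersolution of the recursion. The counting
-- hypothesis is inherited: a draw outside `γ` lowers the count by one and raises `R` by at least
-- one.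
theorem winProb_le_div (L m K : ℕ) (hL : K + m < L) : ∀ (n : ℕ) (a : Fin n → ℕ)
    (γ : Fin n → Prop) (R : ℕ), (∀ i, 1 ≤ a i) → (∀ i, a i ≤ m) →
    ∑ i, (if γ i then 1 / (a i : ℝ) else 0) = 1 →
    (L : ℝ) - R - 1 ≤ ∑ i, (if γ i then 0 else 1) →
    R ≤ K → winProb a γ R K ≤ ((K : ℝ) + m - R) / (L - R) := by
  have hL' : (K : ℝ) + m < L := by exact_mod_cast hL
  intro n
  induction n with
  | zero => intro a γ R _ _ h; simp at h
  | succ n ih =>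
    intro a γ R ha ham hγ hcount hR
    have hR' : (R : ℝ) ≤ K := by exact_mod_cast hR
    have hpos : 0 < 1 + ∑ p, (if γ p then 0 else 1 / (a p : ℝ)) := by
      have : 0 ≤ ∑ p, (if γ p then 0 else 1 / (a p : ℝ)) :=
        Finset.sum_nonneg fun p _ => by split_ifs <;> positivity
      linarith
    have hm0 : (0 : ℝ) ≤ m := by positivity
    have ha' : ∀ i, (1 : ℝ) ≤ a i := fun i => by exact_mod_cast ha i
    have ham' : ∀ i, (a i : ℝ) ≤ m := fun i => by exact_mod_cast ham i
    have hLR : 0 < (L : ℝ) - R := by linarith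
    have hden : ∀ p, 0 < (L : ℝ) - R - a p := fun p => by linarith [ham' p]
    refine le_of_mul_le_mul_right ?_ hpos
    rw [winProb_succ_mul ha γ hγ hR]
    set c : ℝ := L - K - m with hc
    have hc0 : 0 < c := by linarith
    have step : ∑ p, (if γ p then 0 else 1 / (a p : ℝ) *
          winProb (fun j => a (skip p j)) (fun j => γ (skip p j)) (R + a p) K) ≤
        ∑ p, (if γ p then 0 else 1 / (a p : ℝ) * (1 - c / (L - R - a p))) := by
      refine Finset.sum_le_sum fun p _ => ?_
      by_cases hp : γ p
      · simp [hp]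
      simp only [hp, if_false]
      refine mul_le_mul_of_nonneg_left ?_ (by positivity)
      -- Past `K` the true value is 0, and the claimed bound is still nonnegative because one
      -- request overshoots by at most `m`; this is why `m` appears in the numerator.
      rcases lt_or_ge K (R + a p) with h | h
      · rw [winProb_eq_zero_of_lt _ _ h, sub_nonneg, div_le_one (hden p)]
        linarith [ham' p]
      · refine (ih _ _ (R + a p) (fun j => ha _) (fun j => ham _) ?_ ?_ h).trans (le_of_eq ?_)
        · rw [sum_skip p (fun i => if γ i then 1 / (a i : ℝ) else 0), hγ]
          simp [hp]
        · rw [sum_skip p (fun i => if γ i then (0 : ℝ) else 1)]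
          simp only [hp, if_false]
          push_cast
          linarith [ha' p]
        · have := (hden p).ne'
          push_cast
          rw [← sub_sub, ← sub_sub, eq_sub_iff_add_eq, ← add_div, div_eq_one_iff_eq this]
          linarith
    have expand : ∑ p, (if γ p then 0 else 1 / (a p : ℝ) * (1 - c / (L - R - a p))) =
        (1 - c / (L - R)) * ∑ p, (if γ p then 0 else 1 / (a p : ℝ)) -
        c / (L - R) * ∑ p, (if γ p then 0 else 1 / ((L : ℝ) - R - a p)) := by
      rw [Finset.mul_sum, Finset.mul_sum, ← Finset.sum_sub_distrib]
      refine Finset.sum_congr rfl fun p _ => ?_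
      split_ifs
      · simp
      · have h1 := (hden p).ne'
        have h2 : (a p : ℝ) ≠ 0 := by linarith [ha' p]
        field_simp
        ring
    -- Each of the at least `L-R-1` terms is at least `1/(L-R-1)`, as requests are at least 1.
    have hbound : 1 ≤ ∑ p, (if γ p then 0 else 1 / ((L : ℝ) - R - a p)) := by
      by_cases hd : (L : ℝ) - R - 1 ≤ 0
      · exfalso
        obtain ⟨p⟩ : Nonempty (Fin (n + 1)) := inferInstance
        linarith [ha' p, ham' p]
      push Not at hd
      calc (1 : ℝ) = 1 / (L - R - 1) * (L - R - 1) := by field_simp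
        _ ≤ 1 / (L - R - 1) * ∑ i, (if γ i then 0 else 1) :=
          mul_le_mul_of_nonneg_left hcount (by positivity)
        _ ≤ _ := by
          rw [Finset.mul_sum]
          refine Finset.sum_le_sum fun p _ => ?_
          split_ifs
          · simp
          · rw [mul_one]
            exact one_div_le_one_div_of_le (hden p) (by linarith [ha' p])
    have hb : ((K : ℝ) + m - R) / (L - R) = 1 - c / (L - R) := by
      field_simp
      rw [hc]
      ring
    rw [hb]
    have := mul_le_mul_of_nonneg_left hbound (div_pos hc0 hLR).le
    linarith

/-! ### Expected utilities under group requests -/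

theorem sum_before {n : ℕ} (a : Fin n → ℕ) (σ : Equiv.Perm (Fin n)) (t : Fin n) :
    ∑ j ∈ before σ t, a j = ∑ s ∈ Finset.Iio t, a (σ s) :=
  Finset.sum_image σ.injective.injOn

theorem expectedUtility_weightedIndividualLottery (I : LotteryInstance)
    (a : Fin I.n → Request I.k) (i : Fin I.n) :
    I.expectedUtility i (weightedIndividualLottery a) =
      ∑ σ, orderProb a σ * I.utility i (allocate a σ) := by
  simp only [LotteryInstance.expectedUtility, weightedIndividualLottery, Finset.sum_mul]
  rw [Finset.sum_comm]
  refine Finset.sum_congr rfl fun σ _ => ?_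
  simp [ite_mul]

/-- If the first member of `G` cannot be served in full, it takes all that is left, fewer than `|G|`
tickets, and later members get nothing. Conversely, one fully served member already holds `|G|`
tickets. -/
theorem card_le_sum_ticketsOf_iff {n k : ℕ} (a : Fin n → Request k) (G : Finset (Fin n))
    (hG : G.Nonempty) (haG : ∀ j ∈ G, (a j : ℕ) = G.card) (hk : G.card ≤ k)
    (σ : Equiv.Perm (Fin n)) :
    G.card ≤ ∑ j ∈ G, ticketsOf a σ j ↔
      Wins (fun i => (a i : ℕ)) (· ∈ G) 0 (k - G.card) σ := by
  constructor
  · intro h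
    obtain ⟨j₀, hj₀, hmin⟩ := G.exists_min_image σ.symm hG
    refine ⟨σ.symm j₀, by simpa using hj₀, ?_⟩
    by_contra hlt
    have hB : k - G.card < ∑ j ∈ before σ (σ.symm j₀), (a j : ℕ) := by
      rw [sum_before (fun i => (a i : ℕ))]
      simpa using hlt
    have hzero : ∀ j ∈ G, j ≠ j₀ → ticketsOf a σ j = 0 := by
      intro j hj hne
      have hlt' : σ.symm j₀ < σ.symm j :=
        lt_of_le_of_ne (hmin j hj) fun h => hne (σ.symm.injective h).symm
      have hsub : insert j₀ (before σ (σ.symm j₀)) ⊆ before σ (σ.symm j) := by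
        intro x hx
        simp only [before, Finset.mem_insert, Finset.mem_image, Finset.mem_Iio] at hx ⊢
        rcases hx with rfl | ⟨r, hr, rfl⟩
        · exact ⟨σ.symm x, hlt', by simp⟩
        · exact ⟨r, hr.trans hlt', rfl⟩
      have hnot : j₀ ∉ before σ (σ.symm j₀) := by
        simp only [before, Finset.mem_image, Finset.mem_Iio, not_exists, not_and]
        rintro r hr rfl
        simp at hr
      have hle := Finset.sum_le_sum_of_subset (f := fun i => (a i : ℕ)) hsub
      rw [Finset.sum_insert hnot, haG j₀ hj₀] at hle
      unfold ticketsOf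
      omega
    rw [Finset.sum_eq_single_of_mem j₀ hj₀ hzero] at h
    have hpos : 0 < G.card := hG.card_pos
    unfold ticketsOf at h
    omega
  · rintro ⟨t, ht, hle⟩
    refine le_trans ?_ (Finset.single_le_sum (f := ticketsOf a σ) (fun _ _ => Nat.zero_le _) ht)
    have := haG _ ht
    simp only [ticketsOf, Equiv.symm_apply_apply]
    rw [sum_before (fun i => (a i : ℕ))]
    beta_reduce at hle ⊢
    omega

namespace LotteryInstance

variable (I : LotteryInstance)

theorem mem_group (i : Fin I.n) : i ∈ I.group i := I.groups.mem_part (Finset.mem_univ i)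

theorem group_eq_of_mem {i j : Fin I.n} (h : j ∈ I.group i) : I.group j = I.group i :=
  I.groups.part_eq_of_mem (I.groups.part_mem.2 (Finset.mem_univ i)) h

theorem card_group_pos (i : Fin I.n) : 1 ≤ (I.group i).card :=
  Finset.card_pos.2 ⟨i, I.mem_group i⟩

theorem card_group_le (i : Fin I.n) : (I.group i).card ≤ I.maxGroupSize :=
  Finset.le_sup (f := Finset.card) (I.groups.part_mem.2 (Finset.mem_univ i))

theorem expectedUtility_groupRequest (h : I.maxGroupSize ≤ I.k) (i : Fin I.n) :
    I.expectedUtility i (weightedIndividualLottery (I.groupRequest h)) =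
      winProb (fun j => (I.group j).card) (· ∈ I.group i) 0 (I.k - (I.group i).card) := by
  rw [expectedUtility_weightedIndividualLottery]
  unfold winProb
  refine Finset.sum_congr rfl fun σ _ => ?_
  have := card_le_sum_ticketsOf_iff (I.groupRequest h) (I.group i) ⟨i, I.mem_group i⟩
    (fun j hj => congrArg Finset.card (I.group_eq_of_mem hj)) ((I.card_group_le i).trans h) σ
  refine congrArg₂ (· * ·) rfl ?_
  unfold utility
  classical exact if_congr this rfl rfl

theorem sum_weight_group (i : Fin I.n) :
    ∑ j, (if j ∈ I.group i then 1 / ((I.group j).card : ℝ) else 0) = 1 := by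
  have h0 : ((I.group i).card : ℝ) ≠ 0 := by
    have := I.card_group_pos i
    positivity
  rw [Finset.sum_ite_mem, Finset.univ_inter,
    Finset.sum_congr rfl fun j hj => by rw [I.group_eq_of_mem hj], Finset.sum_const, nsmul_eq_mul]
  field_simp

theorem sum_compl_group (i : Fin I.n) (c : ℝ) :
    ∑ j, (if j ∈ I.group i then 0 else c) = ((I.n : ℝ) - (I.group i).card) * c := by
  have h : ∀ j, (if j ∈ I.group i then 0 else c) = c - if j ∈ I.group i then c else 0 := by
    intro j
    split_ifs <;> simp
  simp only [h]
  rw [Finset.sum_sub_distrib, Finset.sum_ite_mem, Finset.univ_inter]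
  simp [sub_mul]

theorem one_sub_exp_le_expectedUtility (h : I.maxGroupSize ≤ I.k) (hkn : I.k < I.n)
    (i : Fin I.n) :
    1 - Real.exp (-(((I.k : ℝ) - I.maxGroupSize + 1) / I.n)) ≤
      I.expectedUtility i (weightedIndividualLottery (I.groupRequest h)) := by
  classical
  rw [expectedUtility_groupRequest]
  set s := (I.group i).card with hs
  set m := I.maxGroupSize with hm
  have hs1 : 1 ≤ s := I.card_group_pos i
  have hsm : s ≤ m := I.card_group_le i
  have hs1' : (1 : ℝ) ≤ s := by exact_mod_cast hs1
  have hsm' : (s : ℝ) ≤ m := by exact_mod_cast hsm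
  have hmk' : (m : ℝ) ≤ I.k := by exact_mod_cast h
  have hkn' : (I.k : ℝ) < I.n := by exact_mod_cast hkn
  -- Chosen so that `exp x ≤ 1/(1-x)` bounds the term of a request `b ≤ m` by `1/(n-s+m-b) ≤
  -- 1/(n-s)`; the `n-s` outsiders then contribute at most 1.
  set θ : ℝ := 1 / (I.n - s + m) with hθ
  have hd : (0 : ℝ) < I.n - s + m := by linarith
  have hθ0 : 0 < θ := by positivity
  have hns : (0 : ℝ) < I.n - s := by linarith
  have key := one_sub_exp_le_winProb θ hθ0.le (I.k - s) I.n (fun j => (I.group j).card)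
    (· ∈ I.group i) 0 I.card_group_pos ?_ ?_
  · refine le_trans ?_ key
    have : Real.exp (θ * (((0 : ℕ) : ℝ) - (((I.k - s : ℕ) : ℝ) + 1))) ≤
        Real.exp (-(((I.k : ℝ) - m + 1) / I.n)) := by
      rw [Real.exp_le_exp, Nat.cast_sub (hsm.trans h), hθ]
      -- Adding `m - s ≥ 0` to numerator and denominator does not decrease a fraction that is at
      -- most 1.
      have : ((I.k : ℝ) - m + 1) / I.n ≤ (I.k - s + 1) / (I.n - s + m) := by
        rw [div_le_div_iff₀ (by linarith) hd]
        nlinarith [mul_nonneg (sub_nonneg.2 hsm') (by linarith : (0 : ℝ) ≤ I.n - (I.k - m + 1))]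
      calc _ = -(((I.k : ℝ) - s + 1) / (I.n - s + m)) := by push_cast; ring
        _ ≤ _ := neg_le_neg this
    linarith
  · convert I.sum_weight_group i
  · calc _ ≤ ∑ j, (if j ∈ I.group i then 0 else 1 / ((I.n : ℝ) - s)) := by
          refine Finset.sum_le_sum fun j _ => ?_
          split_ifs with hj
          · exact le_rfl
          have hb1 : (1 : ℝ) ≤ (I.group j).card := by exact_mod_cast I.card_group_pos j
          have hbm : ((I.group j).card : ℝ) ≤ m := by exact_mod_cast I.card_group_le j
          generalize ((I.group j).card : ℝ) = b at hb1 hbm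
          have hx : θ * b < 1 := by
            rw [hθ, one_div_mul_eq_div, div_lt_one hd]
            linarith
          have hexp : Real.exp (θ * b) ≤ 1 / (1 - θ * b) := by
            rw [le_div_iff₀ (by linarith)]
            have h1 : 1 - θ * b ≤ Real.exp (-(θ * b)) := by
              linarith [Real.add_one_le_exp (-(θ * b))]
            calc _ ≤ Real.exp (θ * b) * Real.exp (-(θ * b)) :=
                  mul_le_mul_of_nonneg_left h1 (Real.exp_pos _).le
              _ = 1 := by rw [← Real.exp_add]; simp
          have hval : 1 / (1 - θ * b) - 1 = b / (I.n - s + m - b) := by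
            have h2 : (I.n : ℝ) - s + m - b ≠ 0 := by linarith
            have h3 : 1 - θ * b = (I.n - s + m - b) / (I.n - s + m) := by
              rw [hθ]; field_simp
            rw [h3]
            field_simp
            ring
          calc 1 / b * (Real.exp (θ * b) - 1) ≤ 1 / b * (b / (I.n - s + m - b)) := by
                refine mul_le_mul_of_nonneg_left ?_ (by positivity)
                linarith
            _ = 1 / (I.n - s + m - b) := by field_simp
            _ ≤ _ := one_div_le_one_div_of_le hns (by linarith)
      _ = 1 := by
          rw [I.sum_compl_group, ← hs]
          field_simp

theorem expectedUtility_le_div (h : I.maxGroupSize ≤ I.k) (i : Fin I.n) :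
    I.expectedUtility i (weightedIndividualLottery (I.groupRequest h)) ≤
      ((I.k : ℝ) + I.maxGroupSize - 1) / I.n := by
  classical
  rw [expectedUtility_groupRequest]
  set s := (I.group i).card with hs
  set m := I.maxGroupSize with hm
  have hs1 : 1 ≤ s := I.card_group_pos i
  have hsm : s ≤ m := I.card_group_le i
  have hs1' : (1 : ℝ) ≤ s := by exact_mod_cast hs1
  have hn : (0 : ℝ) < I.n := by exact_mod_cast I.n_pos
  -- If `n ≤ k+m-1` the bound is at least 1; otherwise `K + m < L` holds for `L = n-s+1`, `K = k-s`.
  rcases le_or_gt I.n (I.k + m - 1) with hc | hc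
  · refine (winProb_le_one I.card_group_pos _ _ _).trans ?_
    rw [one_le_div hn]
    have : ((I.n + 1 : ℕ) : ℝ) ≤ (I.k + m : ℕ) := by
      exact_mod_cast (by omega : I.n + 1 ≤ I.k + m)
    push_cast at this
    linarith
  have hsn : s ≤ I.n := by omega
  have hc' : (I.k : ℝ) + m ≤ I.n := by exact_mod_cast (by omega : I.k + m ≤ I.n)
  have hmk' : (m : ℝ) ≤ I.k := by exact_mod_cast h
  have hsm' : (s : ℝ) ≤ m := by exact_mod_cast hsm
  refine (winProb_le_div (I.n - s + 1) m (I.k - s) (by omega) I.n _ _ 0 I.card_group_pos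
    I.card_group_le (by convert I.sum_weight_group i) ?_ (Nat.zero_le _)).trans ?_
  · have hcount := I.sum_compl_group i 1
    rw [← hs, mul_one] at hcount
    have : ((I.n - s + 1 : ℕ) : ℝ) - ((0 : ℕ) : ℝ) - 1 = I.n - s := by
      push_cast [Nat.cast_sub hsn]
      ring
    rw [this, ← hcount]
    exact le_of_eq (by congr!)
  · push_cast [Nat.cast_sub hsn, Nat.cast_sub (hsm.trans h)]
    -- `(k-s+m)/(n-s+1)` arises from `(k+m-1)/n ≤ 1` by subtracting `s-1` above and below.
    rw [div_le_div_iff₀ (by linarith) hn]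
    nlinarith [mul_nonneg (sub_nonneg.2 hs1') (by linarith : (0 : ℝ) ≤ I.n - (I.k + m - 1))]

end LotteryInstance

/-! ### The function `g` and the final estimates -/

theorem g_pos {α : ℝ} (hα : 0 < α) : 0 < g α :=
  div_pos (sub_pos.2 (Real.exp_lt_one_iff.2 (by linarith))) hα

/-- The concave function `1 - exp(-x)` lies above its chord on `[0, α]`, whose slope is `g α`. -/
theorem mul_g_le_one_sub_exp {x α : ℝ} (hx : 0 ≤ x) (hα : 0 < α) (hxα : x ≤ α) :
    x * g α ≤ 1 - Real.exp (-x) := by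
  have h := convexOn_exp.2 (Set.mem_univ (-α)) (Set.mem_univ 0) (div_nonneg hx hα.le)
    (sub_nonneg.2 ((div_le_one hα).2 hxα)) (by ring)
  simp only [smul_eq_mul, mul_zero, add_zero, Real.exp_zero, mul_one] at h
  have e1 : x / α * -α = -x := by field_simp
  rw [e1] at h
  have e2 : x * g α = x / α - x / α * Real.exp (-α) := by
    unfold g; ring
  linarith

end

end TicketLottery

open TicketLottery in
theorem mainTheorem2 (κ α : ℝ) (hκ : κ ∈ Set.Ioo (0 : ℝ) 1) (hα : α ∈ Set.Ioo (0 : ℝ) 1)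
    (I : TicketLottery.LotteryInstance) (hI : I ∈ TicketLottery.instanceFamily κ α) :
    I.IsEfficient ((1 - κ) * TicketLottery.g α)
        (TicketLottery.weightedIndividualLottery
          (I.groupRequest (TicketLottery.maxGroupSize_le hκ.2 hI))) ∧
      I.IsFair ((1 - 2 * κ) * TicketLottery.g α)
        (TicketLottery.weightedIndividualLottery
          (I.groupRequest (TicketLottery.maxGroupSize_le hκ.2 hI))) := by
  have hm := TicketLottery.maxGroupSize_le hκ.2 hI
  obtain ⟨h1, h2⟩ := hI
  obtain ⟨hκ0, hκ1⟩ := hκ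
  obtain ⟨hα0, hα1⟩ := hα
  have hk : (0 : ℝ) < I.k := by exact_mod_cast I.k_pos
  have hn : (0 : ℝ) < I.n := by exact_mod_cast I.n_pos
  rw [div_le_iff₀ hk] at h1
  have hkn : I.k < I.n := by
    have := h2.trans_lt hα1
    rw [div_lt_one hn] at this
    exact_mod_cast this
  have hg := TicketLottery.g_pos hα0
  set π := TicketLottery.weightedIndividualLottery (I.groupRequest hm) with hπ
  have lower : ∀ i, (1 - κ) * (I.k / I.n) * g α ≤ I.expectedUtility i π := by
    intro i
    refine le_trans ?_ (I.one_sub_exp_le_expectedUtility hm hkn i)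
    have hq : 0 < (I.k : ℝ) / I.n := by positivity
    refine (mul_g_le_one_sub_exp (mul_nonneg (by linarith) hq.le) hα0 (by nlinarith)).trans ?_
    refine sub_le_sub_left (Real.exp_le_exp.2 (neg_le_neg ?_)) 1
    rw [← mul_div_assoc, div_le_div_iff_of_pos_right hn]
    linarith
  have upper : ∀ i, I.expectedUtility i π ≤ (1 + κ) * (I.k / I.n) := by
    intro i
    refine (I.expectedUtility_le_div hm i).trans ?_
    rw [← mul_div_assoc, div_le_div_iff_of_pos_right hn]
    linarith
  constructor
  · unfold LotteryInstance.IsEfficient LotteryInstance.utilization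
    have := Finset.sum_le_sum fun i (_ : i ∈ Finset.univ) => lower i
    rw [Finset.sum_const, Finset.card_univ, Fintype.card_fin, nsmul_eq_mul] at this
    rw [one_div_mul_eq_div, le_div_iff₀ hk]
    refine le_trans (le_of_eq ?_) this
    field_simp
  · intro i i'
    have hq : 0 < (I.k : ℝ) / I.n := by positivity
    have hpos : 0 ≤ (1 - κ) * (I.k / I.n) * g α :=
      mul_nonneg (mul_nonneg (by linarith) hq.le) hg.le
    -- For `κ ≥ 1/2` the fairness factor is not positive, so nonnegativity of utilities suffices.
    rcases le_or_gt (1 - 2 * κ) 0 with hκ2 | hκ2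
    · have h0 : 0 ≤ I.expectedUtility i' π := hpos.trans (lower i')
      exact (mul_nonpos_of_nonpos_of_nonneg (mul_nonpos_of_nonpos_of_nonneg hκ2 hg.le) h0).trans
        (hpos.trans (lower i))
    · calc (1 - 2 * κ) * g α * I.expectedUtility i' π
          ≤ (1 - 2 * κ) * g α * ((1 + κ) * (I.k / I.n)) :=
            mul_le_mul_of_nonneg_left (upper i') (mul_pos hκ2 hg).le
        _ = ((1 - 2 * κ) * (1 + κ)) * (I.k / I.n) * g α := by ring
        _ ≤ (1 - κ) * (I.k / I.n) * g α := by
            gcongr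
            nlinarith
        _ ≤ _ := lower i
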